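/- Let $d \ge 0$, and let $\omega = (\omega_e)$ be an environment on $\mathbb{Z}^d$: each unoriented edge $e$ of the nearest-neighbour graph (where $x \sim y$ iff $\|x-y\|_1 = 1$) carries a conductance $\omega_e = \omega_{x,y} = \omega_{y,x} > 0$. Assume that $\omega$ is elliptic, i.e. there exists $M > 0$ such that $\omega_e \in [1,M]$ for every edge $e$. Let $$L^\omega f(x) = \sum_{y \sim x} \omega_{x,y}\,(f(y) - f(x)), \qquad \Gamma_f(x) = (L^\omega f^2 - 2 f L^\omega f)(x) = \sum_{y \sim x} \omega_{x,y}\,(f(y)-f(x))^2 .$$ Let $(X_t)_{t \ge 0}$, with law $\mathbf{P}^\omega_0$, be the càdlàg Markov process on $\mathbb{Z}^d$ started from $0$ with jump rate $\omega_{x,y}$ between neighbours $x$ and $y$, i.e. with transition semigroup $e^{tL^\omega}$ on bounded functions. Let $(\mathcal{F}_t)_{t\ge0}$ be the natural filtration of $X$, or more generally any filtration to which $X$ is adapted and with respect to which it has the Markov property: $\mathbf{E}^\omega_0[g(X_{s+t}) \mid \mathcal{F}_s] = (e^{tL^\omega} g)(X_s)$ almost surely, for all $s, t \ge 0$ and all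 bounded $g : \mathbb{Z}^d \to \mathbb{R}$. Let $f : \mathbb{Z}^d \to \mathbb{R}$ have subexponential growth: for every $\alpha > 0$, $\sup_{B_n} |f| = O(e^{\alpha n})$ as $n \to \infty$, where $B_n = \{-n,\ldots,n\}^d$. Then the process $$M_f(t) = f(X_t) - f(X_0) - \int_0^t L^\omega f(X_s)\, \mathrm{d}s$$ is an $(\mathcal{F}_t)$-martingale under $\mathbf{P}^\omega_0$, and its (predictable) quadratic variation is $$\langle M_f \rangle_t = \int_0^t \Gamma_f(X_s)\, \mathrm{d}s ,$$ that is: $M_f$ is càdlàg and square-integrable, the process $t \mapsto \int_0^t \Gamma_f(X_s)\,\mathrm{d}s$ is predictable, null at $0$, nondecreasing and càdlàg, and $M_f(t)^2 - \int_0^t \Gamma_f(X_s)\,\mathrm{d}s$ is an $(\mathcal{F}_t)$-martingale under $\mathbf{P}^\omega_0$. -/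

import Mathlib

open MeasureTheory ProbabilityTheory Filter Topology Asymptotics
open scoped NNReal Nat

noncomputable section

namespace RandomConductance

/-- The nearest-neighbour graph on `ℤ^d`: `x ∼ y` iff `‖x - y‖₁ = 1`. -/
def latticeGraph (d : ℕ) : SimpleGraph (Fin d → ℤ) where
  Adj x y := ∑ i, |x i - y i| = 1
  symm := ⟨fun x y h => by simpa only [abs_sub_comm] using h⟩
  loopless := ⟨fun x h => by simp at h⟩

/-- Neighbours of `x` have all their coordinates at distance at most one from those of `x`. -/
theorem latticeGraph_neighborSet_finite {d : ℕ} (x : Fin d → ℤ) :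
    ((latticeGraph d).neighborSet x).Finite := by
  refine (Set.finite_Icc (fun i => x i - 1) (fun i => x i + 1)).subset ?_
  intro y hy
  have hy' : ∑ i, |x i - y i| = 1 := hy
  have h : ∀ i, |x i - y i| ≤ 1 := fun i => by
    rw [← hy']
    exact Finset.single_le_sum (f := fun i => |x i - y i|) (fun j _ => abs_nonneg _)
      (Finset.mem_univ i)
  refine ⟨fun i => ?_, fun i => ?_⟩
  · have := abs_le.1 (h i)
    show x i - 1 ≤ y i
    linarith
  · have := abs_le.1 (h i)
    show y i ≤ x i + 1
    linarith

instance (d : ℕ) : (latticeGraph d).LocallyFinite :=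
  fun x => (latticeGraph_neighborSet_finite x).fintype

/-- An environment: a positive conductance on each unoriented edge of `ℤ^d`. -/
abbrev Environment (d : ℕ) : Type := (latticeGraph d).edgeSet → Set.Ioi (0 : ℝ)

/-- Ellipticity: all the conductances lie in `[1, M]` for some `M > 0`. -/
def IsElliptic {d : ℕ} (ω : Environment d) : Prop :=
  ∃ M : ℝ, 0 < M ∧ ∀ e, (ω e : ℝ) ∈ Set.Icc 1 M

open Classical in
/-- The conductance `ω_{x,y}` of the edge between `x` and `y` (zero if there is no such edge). -/
def conductance {d : ℕ} (ω : Environment d) (x y : Fin d → ℤ) : ℝ :=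
  if h : (latticeGraph d).Adj x y then
    (ω ⟨s(x, y), (SimpleGraph.mem_edgeSet (latticeGraph d)).2 h⟩ : ℝ) else 0

/-- The generator `L^ω f(x) = ∑_{y ∼ x} ω_{x,y} (f(y) - f(x))`. -/
def generator {d : ℕ} (ω : Environment d) (f : (Fin d → ℤ) → ℝ) (x : Fin d → ℤ) : ℝ :=
  ∑ y ∈ (latticeGraph d).neighborFinset x, conductance ω x y * (f y - f x)

/-- The carré du champ `Γ_f = L^ω f² - 2 f L^ω f`. -/
def carreDuChamp {d : ℕ} (ω : Environment d) (f : (Fin d → ℤ) → ℝ) (x : Fin d → ℤ) : ℝ :=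
  generator ω (fun y => f y ^ 2) x - 2 * f x * generator ω f x

theorem carreDuChamp_eq_sum {d : ℕ} (ω : Environment d) (f : (Fin d → ℤ) → ℝ) (x : Fin d → ℤ) :
    carreDuChamp ω f x =
      ∑ y ∈ (latticeGraph d).neighborFinset x, conductance ω x y * (f y - f x) ^ 2 := by
  unfold carreDuChamp generator
  rw [Finset.mul_sum, ← Finset.sum_sub_distrib]
  exact Finset.sum_congr rfl fun y _ => by ring

/-- The semigroup `e^{tL} g = ∑ₙ tⁿ/n! Lⁿ g` of the Markov process with jump rates `ω_{x,y}`.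
It is applied to bounded `g` in elliptic environments, where the jump rates are bounded, so that
`L^ω` is a bounded operator for the sup norm and the series converges absolutely. -/
def semigroup {d : ℕ} (ω : Environment d) (t : ℝ≥0) (g : (Fin d → ℤ) → ℝ) (x : Fin d → ℤ) : ℝ :=
  ∑' n : ℕ, (t : ℝ) ^ n / (n ! : ℝ) * ((generator ω)^[n] g) x

/-- In an elliptic environment, the series defining `semigroup` converges absolutely on bounded
functions. -/
theorem semigroup_summable {d : ℕ} {ω : Environment d} (hω : IsElliptic ω) (t : ℝ≥0)
    {g : (Fin d → ℤ) → ℝ} (hg : ∃ C : ℝ, ∀ x, |g x| ≤ C) (x : Fin d → ℤ) :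
    Summable fun n : ℕ => |(t : ℝ) ^ n / (n ! : ℝ) * ((generator ω)^[n] g) x| := by
  obtain ⟨M, hM, hM'⟩ := hω
  obtain ⟨C, hC⟩ := hg
  have hcard : ∀ x : Fin d → ℤ, ((latticeGraph d).neighborFinset x).card ≤ 3 ^ d := by
    intro x
    calc _ ≤ (Finset.Icc (fun i => x i - 1) (fun i => x i + 1)).card := by
          refine Finset.card_le_card fun y hy => ?_
          have hy' : ∑ i, |x i - y i| = 1 := (SimpleGraph.mem_neighborFinset _ _ _).1 hy
          have h : ∀ i, |x i - y i| ≤ 1 := fun i => by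
            rw [← hy']
            exact Finset.single_le_sum (f := fun i => |x i - y i|) (fun j _ => abs_nonneg _)
              (Finset.mem_univ i)
          refine Finset.mem_Icc.2 ⟨fun i => ?_, fun i => ?_⟩ <;>
          · have := abs_le.1 (h i)
            simp only
            linarith
      _ = 3 ^ d := by
          rw [Pi.card_Icc]
          simp only [Int.card_Icc]
          have : ∀ i, (x i + 1 + 1 - (x i - 1)).toNat = 3 := fun i => by omega
          simp [this]
  have hc : ∀ x y, |conductance ω x y| ≤ M := by
    intro x y
    unfold conductance
    split_ifs with h
    · have := hM' ⟨s(x, y), (SimpleGraph.mem_edgeSet (latticeGraph d)).2 h⟩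
      rw [abs_of_nonneg (by linarith [this.1])]
      exact this.2
    · simpa using hM.le
  set K : ℝ := 3 ^ d * (M * 2) with hK
  have hL : ∀ (h : (Fin d → ℤ) → ℝ) (B : ℝ), (∀ x, |h x| ≤ B) → ∀ x, |generator ω h x| ≤ K * B := by
    intro h B hB x
    have hB0 : 0 ≤ B := (abs_nonneg _).trans (hB x)
    calc |generator ω h x|
        ≤ ∑ y ∈ (latticeGraph d).neighborFinset x, |conductance ω x y * (h y - h x)| :=
          Finset.abs_sum_le_sum_abs _ _
      _ ≤ ∑ y ∈ (latticeGraph d).neighborFinset x, M * (2 * B) := by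
          refine Finset.sum_le_sum fun y _ => ?_
          rw [abs_mul]
          refine mul_le_mul (hc x y) ?_ (abs_nonneg _) hM.le
          calc |h y - h x| ≤ |h y| + |h x| := abs_sub _ _
            _ ≤ 2 * B := by linarith [hB x, hB y]
      _ = (((latticeGraph d).neighborFinset x).card : ℝ) * (M * (2 * B)) := by
          rw [Finset.sum_const, nsmul_eq_mul]
      _ ≤ 3 ^ d * (M * (2 * B)) := by
          refine mul_le_mul_of_nonneg_right ?_ (by positivity)
          exact_mod_cast hcard x
      _ = K * B := by rw [hK]; ring
  have hn : ∀ n x, |((generator ω)^[n] g) x| ≤ K ^ n * C := by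
    intro n
    induction n with
    | zero => simpa using hC
    | succ n ih =>
      intro x
      rw [Function.iterate_succ_apply', pow_succ', mul_assoc]
      exact hL _ _ ih x
  refine Summable.of_nonneg_of_le (fun _ => abs_nonneg _) (fun n => ?_)
    ((Real.summable_pow_div_factorial (t * K)).mul_right C)
  rw [abs_mul, abs_of_nonneg (by positivity)]
  calc _ ≤ (t : ℝ) ^ n / (n ! : ℝ) * (K ^ n * C) :=
        mul_le_mul_of_nonneg_left (hn n x) (by positivity)
    _ = _ := by rw [mul_pow]; ring

/-- Right-continuous paths with left limits. -/
def IsCadlag {E : Type*} [TopologicalSpace E] (p : ℝ≥0 → E) : Prop :=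
  (∀ t, ContinuousWithinAt p (Set.Ici t) t) ∧ ∀ t, ∃ l, Tendsto p (𝓝[<] t) (𝓝 l)

/-- Under `P`, the process `X` is the Markov process with jump rates `ω_{x,y}` (that is, with
generator `L^ω`) started from `x₀`: it is a càdlàg process with values in `ℤ^d`, adapted to `𝓕`,
which starts from `x₀` and has the Markov property with respect to `𝓕`, with transition semigroup
`e^{tL}`. In particular the law of `X` under `P` is `𝐏^ω_{x₀}`. -/
structure IsConductanceWalk {d : ℕ} (ω : Environment d) (x₀ : Fin d → ℤ)
    {Ω : Type*} {m : MeasurableSpace Ω} (P : Measure Ω) (𝓕 : Filtration ℝ≥0 m)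
    (X : ℝ≥0 → Ω → (Fin d → ℤ)) : Prop where
  isProbabilityMeasure : IsProbabilityMeasure P
  adapted : Adapted 𝓕 X
  cadlag : ∀ a, IsCadlag fun t => X t a
  start : ∀ᵐ a ∂P, X 0 a = x₀
  markov : ∀ s t : ℝ≥0, ∀ g : (Fin d → ℤ) → ℝ, (∃ C : ℝ, ∀ x, |g x| ≤ C) →
    P[fun a => g (X (s + t) a) | 𝓕 s] =ᵐ[P] fun a => semigroup ω t g (X s a)

/-- The additive functional `∫₀ᵗ h(X_s) ds`. -/
def timeIntegral {d : ℕ} {Ω : Type*} (X : ℝ≥0 → Ω → (Fin d → ℤ)) (h : (Fin d → ℤ) → ℝ)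
    (t : ℝ≥0) (a : Ω) : ℝ :=
  ∫ s in (0 : ℝ)..(t : ℝ), h (X s.toNNReal a)

/-- `M_f(t) = f(X_t) - f(X_0) - ∫₀ᵗ L^ω f(X_s) ds`. -/
def dynkinProcess {d : ℕ} {Ω : Type*} (ω : Environment d) (X : ℝ≥0 → Ω → (Fin d → ℤ))
    (f : (Fin d → ℤ) → ℝ) (t : ℝ≥0) (a : Ω) : ℝ :=
  f (X t a) - f (X 0 a) - timeIntegral X (generator ω f) t a

/-- The box `B_n = {-n, …, n}^d`. -/
def box (d n : ℕ) : Finset (Fin d → ℤ) :=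
  Finset.Icc (fun _ => -(n : ℤ)) (fun _ => (n : ℤ))

/-- `sup_{B_n} |f| = O(e^{α n})` for every `α > 0`. -/
def HasSubexponentialGrowth {d : ℕ} (f : (Fin d → ℤ) → ℝ) : Prop :=
  ∀ α : ℝ, 0 < α →
    (fun n : ℕ => ⨆ x : box d n, |f x|) =O[atTop] fun n : ℕ => Real.exp (α * n)

/-- `A` is the predictable quadratic variation `⟨M⟩` of the square-integrable càdlàg martingale
`M`: the process `A` is predictable, starts from zero, has nondecreasing càdlàg paths, and
`M² - A` is a martingale. -/
structure IsPredictableQuadraticVariation {Ω : Type*} {m : MeasurableSpace Ω} (P : Measure Ω)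
    (𝓕 : Filtration ℝ≥0 m) (M A : ℝ≥0 → Ω → ℝ) : Prop where
  martingale : Martingale M 𝓕 P
  cadlag : ∀ a, IsCadlag fun t => M t a
  memLp_two : ∀ t, MemLp (M t) 2 P
  predictable : IsStronglyPredictable 𝓕 A
  zero : ∀ a, A 0 a = 0
  monotone : ∀ a, Monotone fun t => A t a
  cadlag_variation : ∀ a, IsCadlag fun t => A t a
  martingale_sq_sub : Martingale (fun t a => M t a ^ 2 - A t a) 𝓕 P

end RandomConductance

end

open RandomConductance

noncomputable section

namespace RandomConductance

/-! ### The generator on weighted sup-norm spaces -/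

section Generator

variable {d : ℕ} {ω : Environment d}

/-! On functions dominated by a multiple of `e^{α‖x‖}`, the generator `L` is a bounded operator:
degrees and conductances are bounded, and the weight changes by a factor at most `e^α` along an
edge. So `|Lⁿ h| ≤ Kⁿ B e^{α‖x‖}`, and the series for `e^{tL}` converges on such functions. The same
`K` serves the bounded weights `e^{α min(‖x‖, N)}` for every `N`; the Markov property for these and
Fatou's lemma give exponential moments of `X_t`, locally bounded in time. Truncation, with the
locality of `L`, then extends the Markov property to every exponentially bounded function.

For an event `A` of `𝓕 s`, the maps `t ↦ E[f(X_{s+t}); A]` and `t ↦ E[Lf(X_{s+t}); A]` are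
exponential generating series whose coefficients differ by a shift. Integrating termwise gives
Dynkin's formula on `A`, and Fubini turns it into the martingale property of `M = M_f`.

For the bracket, put `I_t = ∫₀ᵗ Lf(X_r) dr` and `N_t = I_t M_t - ∫₀ᵗ Lf(X_r) M_r dr`. Algebra gives,
almost surely, `M_f² - ∫ Γ_f = M_{f²} - 2 f(x₀) M_f - 2N`. The first two terms are martingales by
the above, as `f²` is also exponentially bounded. So is `N`, because `N_t - N_s = I_s (M_t - M_s) +
∫_s^t Lf(X_r) (M_t - M_r) dr` and each increment of `M` is orthogonal to the square-integrable past.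
The compensator is continuous, nondecreasing and adapted, hence predictable. -/

theorem norm_sub_le_one_of_adj {x y : Fin d → ℤ} (h : (latticeGraph d).Adj x y) :
    ‖x - y‖ ≤ 1 := by
  have h' : ∑ i, |x i - y i| = 1 := h
  refine (pi_norm_le_iff_of_nonneg zero_le_one).2 fun i => ?_
  have : |x i - y i| ≤ 1 := h' ▸
    Finset.single_le_sum (f := fun i => |x i - y i|) (fun j _ => abs_nonneg _) (Finset.mem_univ i)
  rw [Pi.sub_apply, Int.norm_eq_abs]
  exact_mod_cast this

theorem card_neighborFinset_le (x : Fin d → ℤ) :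
    ((latticeGraph d).neighborFinset x).card ≤ 3 ^ d := by
  calc _ ≤ (Finset.Icc (fun i => x i - 1) (fun i => x i + 1)).card := by
        refine Finset.card_le_card fun y hy => ?_
        have hy' : ∑ i, |x i - y i| = 1 := (SimpleGraph.mem_neighborFinset _ _ _).1 hy
        have h : ∀ i, |x i - y i| ≤ 1 := fun i => by
          rw [← hy']
          exact Finset.single_le_sum (f := fun i => |x i - y i|) (fun j _ => abs_nonneg _)
            (Finset.mem_univ i)
        refine Finset.mem_Icc.2 ⟨fun i => ?_, fun i => ?_⟩ <;>
        · have := abs_le.1 (h i)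
          simp only
          linarith
    _ = 3 ^ d := by
        rw [Pi.card_Icc]
        simp only [Int.card_Icc]
        have : ∀ i, (x i + 1 + 1 - (x i - 1)).toNat = 3 := fun i => by omega
        simp [this]

theorem conductance_nonneg (x y : Fin d → ℤ) : 0 ≤ conductance ω x y := by
  unfold conductance
  split_ifs with h
  · exact (ω _).2.le
  · exact le_rfl

theorem carreDuChamp_nonneg (ω : Environment d) (f : (Fin d → ℤ) → ℝ) (x : Fin d → ℤ) :
    0 ≤ carreDuChamp ω f x := by
  rw [carreDuChamp_eq_sum]
  exact Finset.sum_nonneg fun y _ => mul_nonneg (conductance_nonneg x y) (sq_nonneg _)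

theorem IsElliptic.exists_conductance_le (hω : IsElliptic ω) :
    ∃ M : ℝ, 0 < M ∧ ∀ x y, |conductance ω x y| ≤ M := by
  obtain ⟨M, hM, hM'⟩ := hω
  refine ⟨M, hM, fun x y => ?_⟩
  rw [abs_of_nonneg (conductance_nonneg x y)]
  unfold conductance
  split_ifs with h
  · exact (hM' _).2
  · exact hM.le

/-- A weight varies by a factor at most `e^α` between neighbours. -/
def IsWeight (α : ℝ) (w : (Fin d → ℤ) → ℝ) : Prop :=
  (∀ x, 0 ≤ w x) ∧ ∀ x y, (latticeGraph d).Adj x y → w y ≤ Real.exp α * w x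

/-- The cutoff keeps the weight bounded, so that the bounded-function Markov property applies to it,
at no cost in the rate: `min ‖·‖ N` is still 1-Lipschitz along edges. -/
theorem isWeight_exp_min {α : ℝ} (hα : 0 ≤ α) (N : ℝ) :
    IsWeight α fun x : Fin d → ℤ => Real.exp (α * min ‖x‖ N) := by
  refine ⟨fun x => (Real.exp_pos _).le, fun x y h => ?_⟩
  rw [← Real.exp_add, Real.exp_le_exp]
  have h1 : ‖y‖ ≤ ‖x‖ + 1 := by
    have := norm_sub_le_one_of_adj h.symm
    have := norm_sub_norm_le y x
    linarith
  have : min ‖y‖ N ≤ 1 + min ‖x‖ N := by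
    rcases le_total ‖x‖ N with h | h
    · rw [min_eq_left h]; exact (min_le_left _ _).trans (by linarith)
    · rw [min_eq_right h]; exact (min_le_right _ _).trans (by linarith)
  nlinarith

theorem isWeight_exp {α : ℝ} (hα : 0 ≤ α) :
    IsWeight α fun x : Fin d → ℤ => Real.exp (α * ‖x‖) := by
  refine ⟨fun x => (Real.exp_pos _).le, fun x y h => ?_⟩
  -- At the level `‖x‖ + ‖y‖` the cutoff is inactive at both points.
  have := (isWeight_exp_min hα (‖x‖ + ‖y‖)).2 x y h
  simpa using this

/-- The norm of the generator on functions dominated by a weight of rate `α`. -/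
theorem IsElliptic.exists_generator_le (hω : IsElliptic ω) (α : ℝ) :
    ∃ K : ℝ, 0 ≤ K ∧ ∀ w, IsWeight α w → ∀ h B, 0 ≤ B → (∀ x, |h x| ≤ B * w x) →
      ∀ x, |generator ω h x| ≤ K * B * w x := by
  obtain ⟨M, hM, hc⟩ := hω.exists_conductance_le
  refine ⟨3 ^ d * (M * (Real.exp α + 1)), by positivity, fun w hw h B hB hh x => ?_⟩
  have hwx := hw.1 x
  calc |generator ω h x|
      ≤ ∑ y ∈ (latticeGraph d).neighborFinset x, |conductance ω x y * (h y - h x)| :=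
        Finset.abs_sum_le_sum_abs _ _
    _ ≤ ∑ y ∈ (latticeGraph d).neighborFinset x, M * (B * (Real.exp α + 1) * w x) := by
        refine Finset.sum_le_sum fun y hy => ?_
        rw [abs_mul]
        refine mul_le_mul (hc x y) ?_ (abs_nonneg _) hM.le
        have hy' := hw.2 x y ((SimpleGraph.mem_neighborFinset _ _ _).1 hy)
        calc |h y - h x| ≤ |h y| + |h x| := abs_sub _ _
          _ ≤ B * w y + B * w x := add_le_add (hh y) (hh x)
          _ ≤ B * (Real.exp α * w x) + B * w x := by gcongr
          _ = _ := by ring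
    _ = (((latticeGraph d).neighborFinset x).card : ℝ) * (M * (B * (Real.exp α + 1) * w x)) := by
        rw [Finset.sum_const, nsmul_eq_mul]
    _ ≤ 3 ^ d * (M * (B * (Real.exp α + 1) * w x)) := by
        refine mul_le_mul_of_nonneg_right ?_ (by positivity)
        exact_mod_cast card_neighborFinset_le x
    _ = _ := by ring

/-- Bounds for the iterates of the generator on functions dominated by a weight of rate `α`. -/
theorem IsElliptic.exists_iterate_generator_le (hω : IsElliptic ω) (α : ℝ) :
    ∃ K : ℝ, 0 ≤ K ∧ ∀ w, IsWeight α w → ∀ h B, 0 ≤ B → (∀ x, |h x| ≤ B * w x) →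
      ∀ n x, |((generator ω)^[n] h) x| ≤ K ^ n * B * w x := by
  obtain ⟨K, hK, hL⟩ := hω.exists_generator_le α
  refine ⟨K, hK, fun w hw h B hB hh n => ?_⟩
  induction n with
  | zero => simpa using hh
  | succ n ih =>
    intro x
    rw [Function.iterate_succ_apply', pow_succ', mul_assoc K]
    exact hL w hw _ _ (by positivity) ih x

/-- Geometric bounds on the iterates make the series termwise smaller than `C` times the series of
`exp (K t)`. -/
theorem summable_semigroup_of_le {h : (Fin d → ℤ) → ℝ} {x : Fin d → ℤ} {K C : ℝ}
    (hh : ∀ n, |((generator ω)^[n] h) x| ≤ K ^ n * C) (t : ℝ) (ht : 0 ≤ t) :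
    Summable (fun n : ℕ => t ^ n / (n ! : ℝ) * ((generator ω)^[n] h) x) ∧
      |∑' n : ℕ, t ^ n / (n ! : ℝ) * ((generator ω)^[n] h) x| ≤ Real.exp (K * t) * C := by
  have hs : HasSum (fun n : ℕ => (t * K) ^ n / (n ! : ℝ) * C) (Real.exp (K * t) * C) := by
    rw [mul_comm K t, Real.exp_eq_exp_ℝ]
    exact (NormedSpace.expSeries_div_hasSum_exp (t * K)).mul_right C
  have hle : ∀ n : ℕ, |t ^ n / (n ! : ℝ) * ((generator ω)^[n] h) x| ≤
      (t * K) ^ n / (n ! : ℝ) * C := fun n => by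
    rw [abs_mul, abs_of_nonneg (by positivity)]
    calc _ ≤ t ^ n / (n ! : ℝ) * (K ^ n * C) :=
          mul_le_mul_of_nonneg_left (hh n) (by positivity)
      _ = _ := by rw [mul_pow]; ring
  refine ⟨Summable.of_norm_bounded hs.summable hle, ?_⟩
  rw [← Real.norm_eq_abs]
  exact tsum_of_norm_bounded hs hle

/-- Functions of at most exponential growth. -/
def IsExpBounded (f : (Fin d → ℤ) → ℝ) : Prop :=
  ∃ α C : ℝ, 0 ≤ α ∧ 0 ≤ C ∧ ∀ x, |f x| ≤ C * Real.exp (α * ‖x‖)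

theorem IsExpBounded.mul {f g : (Fin d → ℤ) → ℝ} (hf : IsExpBounded f) (hg : IsExpBounded g) :
    IsExpBounded fun x => f x * g x := by
  obtain ⟨α, C, hα, hC, hf⟩ := hf
  obtain ⟨β, D, hβ, hD, hg⟩ := hg
  refine ⟨α + β, C * D, by positivity, by positivity, fun x => ?_⟩
  rw [abs_mul, add_mul, Real.exp_add]
  calc _ ≤ (C * Real.exp (α * ‖x‖)) * (D * Real.exp (β * ‖x‖)) :=
        mul_le_mul (hf x) (hg x) (abs_nonneg _) (by positivity)
    _ = _ := by ring

theorem IsExpBounded.sq {f : (Fin d → ℤ) → ℝ} (hf : IsExpBounded f) :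
    IsExpBounded fun x => f x ^ 2 := by
  simpa only [pow_two] using hf.mul hf

theorem IsExpBounded.generator (hω : IsElliptic ω) {f : (Fin d → ℤ) → ℝ} (hf : IsExpBounded f) :
    IsExpBounded (generator ω f) := by
  obtain ⟨α, C, hα, hC, hf⟩ := hf
  obtain ⟨K, hK, hL⟩ := hω.exists_generator_le α
  exact ⟨α, K * C, hα, by positivity, hL _ (isWeight_exp hα) f C hC hf⟩

/-- A single rate, here `α = 1`, is enough for everything that follows: exponentially bounded
functions are stable under products and under the generator. -/
theorem HasSubexponentialGrowth.isExpBounded {f : (Fin d → ℤ) → ℝ}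
    (hf : HasSubexponentialGrowth f) : IsExpBounded f := by
  obtain ⟨C, hC, h⟩ := (hf 1 one_pos).exists_pos
  obtain ⟨N, hN⟩ := eventually_atTop.1 h.bound
  refine ⟨1, C * Real.exp (N + 1), zero_le_one, by positivity, fun x => ?_⟩
  -- Large enough for the growth bound to hold and for the box to contain `x`, yet at most `N + 1 +
  -- ‖x‖`, whence the constant `e^{N+1}`.
  set n : ℕ := max N ⌈‖x‖⌉₊ with hn
  have hxn : ‖x‖ ≤ n := (Nat.le_ceil _).trans (by exact_mod_cast le_max_right _ _)
  have hmem : x ∈ box d n := by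
    have h : ∀ i, |x i| ≤ n := fun i => by
      have := (norm_le_pi_norm x i).trans hxn
      rw [Int.norm_eq_abs] at this
      exact_mod_cast this
    exact Finset.mem_Icc.2 ⟨fun i => (abs_le.1 (h i)).1, fun i => (abs_le.1 (h i)).2⟩
  have h1 : |f x| ≤ ⨆ y : box d n, |f y| :=
    le_ciSup (f := fun y : box d n => |f y|) (Set.finite_range _).bddAbove ⟨x, hmem⟩
  have h2 := (le_abs_self _).trans (hN n (le_max_left _ _))
  have h3 : (n : ℝ) ≤ N + 1 + ‖x‖ := by
    rw [hn, Nat.cast_max]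
    refine max_le (by linarith [norm_nonneg x]) ?_
    have := Nat.ceil_lt_add_one (norm_nonneg x)
    have : (0 : ℝ) ≤ N := Nat.cast_nonneg _
    linarith
  rw [Real.norm_eq_abs, abs_of_pos (Real.exp_pos _), one_mul] at h2
  rw [mul_assoc, ← Real.exp_add, one_mul]
  exact (h1.trans h2).trans (by gcongr)

end Generator

/-! ### Càdlàg paths: measurability, predictability, time integrals -/

/-- A càdlàg path in a discrete space visits finitely many points on a bounded time interval. -/
theorem IsCadlag.finite_image {E : Type*} [TopologicalSpace E] [DiscreteTopology E]
    {p : ℝ≥0 → E} (hp : IsCadlag p) (T : ℝ≥0) : (p '' Set.Iic T).Finite := by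
  have hc : IsCompact (Set.Iic T) := by
    rw [← Set.Icc_bot]; exact isCompact_Icc
  -- By compactness it suffices to work near each time `x`, where the path takes only its left limit
  -- (just before) and its value at `x` (at and just after).
  refine hc.induction_on (p := fun s => (p '' s).Finite) (by simp)
    (fun s t hst ht => ht.subset (Set.image_mono hst))
    (fun s t hs ht => by rw [Set.image_union]; exact hs.union ht) (fun x _ => ?_)
  obtain ⟨l, hl⟩ := hp.2 x
  have h1 : ∀ᶠ r in 𝓝[<] x, p r = l := 
    hl (IsOpen.mem_nhds (isOpen_discrete {l}) rfl)
  have h2 : ∀ᶠ r in 𝓝[≥] x, p r = p x := 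
    (hp.1 x) (IsOpen.mem_nhds (isOpen_discrete {p x}) rfl)
  have h3 : ∀ᶠ r in 𝓝 x, p r ∈ ({l, p x} : Set E) := by
    rw [← nhdsLT_sup_nhdsGE, eventually_sup]
    exact ⟨h1.mono fun r hr => Or.inl hr, h2.mono fun r hr => Or.inr hr⟩
  exact ⟨_, mem_nhdsWithin_of_mem_nhds h3,
    (Set.toFinite {l, p x}).subset (Set.image_subset_iff.2 fun r hr => hr)⟩

/-- A measurable process with right-continuous paths is jointly measurable. -/
theorem measurable_uncurry_of_rightContinuous {Ω E : Type*} [MeasurableSpace Ω]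
    [TopologicalSpace E] [TopologicalSpace.PseudoMetrizableSpace E] [MeasurableSpace E]
    [BorelSpace E] {Y : ℝ≥0 → Ω → E} (hY : ∀ t, Measurable (Y t))
    (hc : ∀ a t, ContinuousWithinAt (fun t => Y t a) (Set.Ici t) t) :
    Measurable (Function.uncurry Y) := by
  -- `q n r` is the point of the grid of mesh `1/(n+1)` just to the right of `r`: it takes countably
  -- many values and tends to `r` from the right.
  obtain ⟨q, hqdef⟩ : ∃ q : ℕ → ℝ≥0 → ℝ≥0, ∀ n r,
      q n r = ((⌊((n : ℝ≥0) + 1) * r⌋₊ : ℝ≥0) + 1) / ((n : ℝ≥0) + 1) := ⟨_, fun _ _ => rfl⟩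
  have hq : ∀ n r, r ≤ q n r ∧ q n r ≤ r + 1 / ((n : ℝ≥0) + 1) := fun n r => by
    have hn : (0 : ℝ≥0) < (n : ℝ≥0) + 1 := by positivity
    rw [hqdef]
    constructor
    · rw [le_div_iff₀ hn, mul_comm]
      exact (Nat.lt_floor_add_one _).le
    · rw [div_le_iff₀ hn, add_mul r, div_mul_cancel₀ _ hn.ne', mul_comm r]
      gcongr
      exact Nat.floor_le zero_le
  refine measurable_of_tendsto_metrizable (f := fun n (z : ℝ≥0 × Ω) => Y (q n z.1) z.2)
    (fun n => ?_) (tendsto_pi_nhds.2 fun z => ?_)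
  · have h1 : Measurable fun z : ℕ × Ω => Y (((z.1 : ℝ≥0) + 1) / ((n : ℝ≥0) + 1)) z.2 :=
      measurable_from_prod_countable_right fun k => hY (((k : ℝ≥0) + 1) / ((n : ℝ≥0) + 1))
    have h2 : Measurable fun z : ℝ≥0 × Ω => (⌊((n : ℝ≥0) + 1) * z.1⌋₊, z.2) :=
      (Nat.measurable_floor.comp (measurable_fst.const_mul _)).prodMk measurable_snd
    simp only [hqdef]
    have h3 := h1.comp h2
    simp only [Function.comp_def] at h3
    exact h3
  · have hlim : Tendsto (fun n => q n z.1) atTop (𝓝 z.1) := by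
      refine tendsto_of_tendsto_of_tendsto_of_le_of_le tendsto_const_nhds ?_
        (fun n => (hq n z.1).1) (fun n => (hq n z.1).2)
      simpa using (tendsto_one_div_add_atTop_nhds_zero_nat (𝕜 := ℝ≥0)).const_add z.1
    exact (hc z.2 z.1).tendsto.comp
      (tendsto_nhdsWithin_iff.2 ⟨hlim, .of_forall fun n => (hq n z.1).1⟩)

/-- A continuous nondecreasing adapted process is predictable. -/
theorem isStronglyPredictable_of_continuous_monotone {Ω : Type*} {m : MeasurableSpace Ω}
    {𝓕 : Filtration ℝ≥0 m} {A : ℝ≥0 → Ω → ℝ} (hA : Adapted 𝓕 A)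
    (hc : ∀ a, Continuous fun t => A t a) (hm : ∀ a, Monotone fun t => A t a) :
    IsStronglyPredictable 𝓕 A := by
  have hM : @Measurable _ _ 𝓕.predictable _ (Function.uncurry A) := by
    refine @measurable_of_Ioi ℝ _ _ _ _ 𝓕.predictable _ _ _ _ fun c => ?_
    obtain ⟨s, hs, hsd⟩ := TopologicalSpace.exists_countable_dense ℝ≥0
    -- If `A t a > c` with `t > 0`, continuity gives a point `q < t` of a countable dense set with
    -- `A q a > c`; monotonicity gives the converse. This writes the set with generators of the
    -- predictable σ-algebra.
    have : Function.uncurry A ⁻¹' Set.Ioi c =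
        ({⊥} ×ˢ {a | c < A ⊥ a}) ∪ ⋃ q ∈ s, Set.Ioi q ×ˢ {a | c < A q a} := by
      ext ⟨t, a⟩
      simp only [Set.mem_preimage, Function.uncurry_apply_pair, Set.mem_Ioi, Set.mem_union,
        Set.mem_prod, Set.mem_singleton_iff, Set.mem_ofPred_eq, Set.mem_iUnion, exists_prop]
      constructor
      · intro h
        rcases eq_or_ne t ⊥ with rfl | ht
        · exact Or.inl ⟨rfl, h⟩
        · right
          have ht' : (⊥ : ℝ≥0) < t := bot_lt_iff_ne_bot.2 ht
          have h1 : ∀ᶠ q in 𝓝 t, c < A q a := (hc a).continuousAt.eventually_const_lt h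
          obtain ⟨l, hl, hlt⟩ := exists_Ioc_subset_of_mem_nhds h1 ⟨⊥, ht'⟩
          obtain ⟨q, hq, hqs⟩ := hsd.exists_between hl
          exact ⟨q, hq, hqs.2, hlt ⟨hqs.1, hqs.2.le⟩⟩
      · rintro (⟨rfl, h⟩ | ⟨q, -, hq, h⟩)
        · exact h
        · exact h.trans_le (hm a hq.le)
    rw [this]
    refine MeasurableSet.union (measurableSet_predictable_singleton_bot_prod
      (hA ⊥ measurableSet_Ioi)) (MeasurableSet.biUnion hs fun q _ =>
        measurableSet_predictable_Ioi_prod (hA q measurableSet_Ioi))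
  exact hM.stronglyMeasurable

section Paths

variable {d : ℕ} {Ω : Type*} {m : MeasurableSpace Ω} {𝓕 : Filtration ℝ≥0 m}
  {X : ℝ≥0 → Ω → (Fin d → ℤ)}

theorem measurable_uncurry_of_adapted (hX : Adapted 𝓕 X) (hc : ∀ a, IsCadlag fun t => X t a) :
    Measurable (Function.uncurry X) :=
  measurable_uncurry_of_rightContinuous (fun _ => hX.measurable) fun a => (hc a).1

/-- Stopping the path at `t` makes all its values `𝓕 t`-measurable, and an integral over `[0, t]`
does not see the stopping; this yields adaptedness of `timeIntegral`. -/
theorem measurable_uncurry_min (hX : Adapted 𝓕 X) (hc : ∀ a, IsCadlag fun t => X t a)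
    (t : ℝ≥0) : Measurable[(inferInstance : MeasurableSpace ℝ≥0).prod (𝓕 t)]
      (Function.uncurry fun r a => X (min r t) a) := by
  let _ := 𝓕 t
  refine @measurable_uncurry_of_rightContinuous Ω _ (𝓕 t) _ _ _ _ _
    (fun r => hX.measurable_le (min_le_right r t)) fun a r => ?_
  refine ((hc a).1 (min r t)).comp (f := fun s => min s t) (t := Set.Ici (min r t))
    ?_ fun s hs => ?_
  · exact (continuous_id.min continuous_const).continuousWithinAt
  · exact min_le_min_right t hs

theorem measurable_path (hX : Adapted 𝓕 X) (hc : ∀ a, IsCadlag fun t => X t a)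
    (h : (Fin d → ℤ) → ℝ) (a : Ω) : Measurable fun r : ℝ => h (X r.toNNReal a) :=
  (Measurable.of_discrete (f := h)).comp ((measurable_uncurry_of_adapted hX hc).comp
    (measurable_real_toNNReal.prodMk measurable_const))

/-- No growth condition on `h` is needed: on a bounded time interval the path visits finitely many
points, so `h` is bounded along it. -/
theorem intervalIntegrable_path (hX : Adapted 𝓕 X) (hc : ∀ a, IsCadlag fun t => X t a)
    (h : (Fin d → ℤ) → ℝ) (a : Ω) (s t : ℝ) :
    IntervalIntegrable (fun r => h (X r.toNNReal a)) volume s t := by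
  rw [intervalIntegrable_iff]
  have hfin := ((hc a).finite_image (max s t).toNNReal).image fun x => |h x|
  obtain ⟨C, hC⟩ := hfin.bddAbove
  refine Measure.integrableOn_of_bounded (M := C) (by simp)
    (measurable_path hX hc h a).aestronglyMeasurable ?_
  refine (ae_restrict_mem measurableSet_uIoc).mono fun r hr => ?_
  exact hC ⟨_, ⟨_, Real.toNNReal_le_toNNReal hr.2, rfl⟩, rfl⟩

theorem timeIntegral_sub (hX : Adapted 𝓕 X) (hc : ∀ a, IsCadlag fun t => X t a)
    (h : (Fin d → ℤ) → ℝ) (s t : ℝ≥0) (a : Ω) :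
    timeIntegral X h t a - timeIntegral X h s a = ∫ r in (s : ℝ)..t, h (X r.toNNReal a) :=
  intervalIntegral.integral_interval_sub_left (intervalIntegrable_path hX hc h a _ _)
    (intervalIntegrable_path hX hc h a _ _)

theorem continuous_timeIntegral (hX : Adapted 𝓕 X) (hc : ∀ a, IsCadlag fun t => X t a)
    (h : (Fin d → ℤ) → ℝ) (a : Ω) : Continuous fun t => timeIntegral X h t a :=
  (intervalIntegral.continuous_primitive
    (fun s t => intervalIntegrable_path hX hc h a s t) 0).comp NNReal.continuous_coe

theorem monotone_timeIntegral (hX : Adapted 𝓕 X) (hc : ∀ a, IsCadlag fun t => X t a)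
    {h : (Fin d → ℤ) → ℝ} (hh : ∀ x, 0 ≤ h x) (a : Ω) :
    Monotone fun t => timeIntegral X h t a := fun s t hst => by
  rw [← sub_nonneg, timeIntegral_sub hX hc]
  exact intervalIntegral.integral_nonneg (by exact_mod_cast hst) fun r _ => hh _

theorem adapted_timeIntegral (hX : Adapted 𝓕 X) (hc : ∀ a, IsCadlag fun t => X t a)
    (h : (Fin d → ℤ) → ℝ) : Adapted 𝓕 (timeIntegral X h) := fun t => by
  have heq : timeIntegral X h t = fun a =>
      ∫ r, h (X (min r.toNNReal t) a) ∂(volume.restrict (Set.Ioc (0 : ℝ) t)) := by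
    ext a
    refine (intervalIntegral.integral_of_le t.2).trans ?_
    refine setIntegral_congr_fun measurableSet_Ioc fun r hr => ?_
    have : r.toNNReal ≤ t := Real.toNNReal_le_iff_le_coe.2 hr.2
    simp [min_eq_left this]
  rw [heq]
  have hm := measurable_uncurry_min hX hc t
  have hm' : Measurable[(𝓕 t).prod inferInstance]
      fun z : Ω × ℝ => h (X (min z.2.toNNReal t) z.1) := by
    let _ := 𝓕 t
    exact (Measurable.of_discrete (f := h)).comp (hm.comp
      ((measurable_real_toNNReal.comp measurable_snd).prodMk measurable_fst))
  let _ := 𝓕 t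
  exact (hm'.stronglyMeasurable.integral_prod_right').measurable

theorem isCadlag_of_continuous {E : Type*} [TopologicalSpace E] {p : ℝ≥0 → E}
    (hp : Continuous p) : IsCadlag p :=
  ⟨fun _ => hp.continuousWithinAt, fun t => ⟨p t, hp.continuousAt.mono_left nhdsWithin_le_nhds⟩⟩

theorem IsCadlag.comp {E F : Type*} [TopologicalSpace E] [TopologicalSpace F] {p : ℝ≥0 → E}
    (hp : IsCadlag p) {f : E → F} (hf : Continuous f) : IsCadlag fun t => f (p t) :=
  ⟨fun t => hf.continuousAt.comp_continuousWithinAt (hp.1 t), fun t =>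
    let ⟨l, hl⟩ := hp.2 t
    ⟨f l, hf.continuousAt.tendsto.comp hl⟩⟩

theorem IsCadlag.sub {E : Type*} [TopologicalSpace E] [AddGroup E] [IsTopologicalAddGroup E]
    {p q : ℝ≥0 → E} (hp : IsCadlag p) (hq : IsCadlag q) : IsCadlag fun t => p t - q t :=
  ⟨fun t => (hp.1 t).sub (hq.1 t), fun t =>
    let ⟨l, hl⟩ := hp.2 t
    let ⟨l', hl'⟩ := hq.2 t
    ⟨l - l', hl.sub hl'⟩⟩

theorem isCadlag_dynkinProcess (ω : Environment d) (hX : Adapted 𝓕 X)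
    (hc : ∀ a, IsCadlag fun t => X t a) (f : (Fin d → ℤ) → ℝ) (a : Ω) :
    IsCadlag fun t => dynkinProcess ω X f t a :=
  (((hc a).comp continuous_of_discreteTopology).sub
    (isCadlag_of_continuous continuous_const)).sub
      (isCadlag_of_continuous (continuous_timeIntegral hX hc _ a))

theorem adapted_dynkinProcess (ω : Environment d) (hX : Adapted 𝓕 X)
    (hc : ∀ a, IsCadlag fun t => X t a) (f : (Fin d → ℤ) → ℝ) :
    Adapted 𝓕 (dynkinProcess ω X f) := fun t =>
  ((Measurable.of_discrete.comp (hX t)).sub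
    (Measurable.of_discrete.comp (hX.measurable_le zero_le))).sub
      (adapted_timeIntegral hX hc _ t)

end Paths

/-! ### Exponential series, semigroup limits and a martingale criterion -/

/-- Termwise integration of an exponential generating series. -/
theorem tsum_sub_eq_integral {c : ℕ → ℝ} {K C : ℝ} (_ : 0 ≤ K) (_ : 0 ≤ C)
    (hc : ∀ n, |c n| ≤ K ^ n * C) {t : ℝ} (ht : 0 ≤ t) :
    ∑' n : ℕ, t ^ n / (n ! : ℝ) * c n - c 0 =
      ∫ r in (0 : ℝ)..t, ∑' n : ℕ, r ^ n / (n ! : ℝ) * c (n + 1) := by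
  have hb : ∀ n : ℕ, ∀ r : ℝ, 0 ≤ r → r ≤ t → |r ^ n / (n ! : ℝ) * c (n + 1)| ≤
      (t * K) ^ n / (n ! : ℝ) * (K * C) := fun n r h0 hr => by
    rw [abs_mul, abs_of_nonneg (by positivity)]
    calc _ ≤ t ^ n / (n ! : ℝ) * (K ^ (n + 1) * C) := by
          gcongr
          exact hc _
      _ = _ := by rw [mul_pow]; ring
  have hbs : Summable fun n : ℕ => (t * K) ^ n / (n ! : ℝ) * (K * C) :=
    (Real.summable_pow_div_factorial (t * K)).mul_right _
  have hsum := intervalIntegral.hasSum_integral_of_dominated_convergence (μ := volume)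
    (a := 0) (b := t) (F := fun n r => r ^ n / (n ! : ℝ) * c (n + 1))
    (f := fun r => ∑' n : ℕ, r ^ n / (n ! : ℝ) * c (n + 1))
    (fun n _ => (t * K) ^ n / (n ! : ℝ) * (K * C))
    (fun n => (by fun_prop : Continuous fun r : ℝ =>
      r ^ n / (n ! : ℝ) * c (n + 1)).aestronglyMeasurable)
    (fun n => .of_forall fun r hr => by
      rw [Set.uIoc_of_le ht] at hr
      exact hb n r hr.1.le hr.2)
    (.of_forall fun r hr => hbs)
    intervalIntegrable_const
    (.of_forall fun r hr => by
      rw [Set.uIoc_of_le ht] at hr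
      exact (Summable.of_norm_bounded hbs fun n => hb n r hr.1.le hr.2).hasSum)
  have hterm : ∀ n : ℕ, ∫ r in (0 : ℝ)..t, r ^ n / (n ! : ℝ) * c (n + 1) =
      t ^ (n + 1) / ((n + 1)! : ℝ) * c (n + 1) := fun n => by
    rw [intervalIntegral.integral_mul_const, intervalIntegral.integral_div, integral_pow,
      Nat.factorial_succ]
    push_cast
    field_simp
    simp
  simp only [hterm] at hsum
  have hs : Summable fun n : ℕ => t ^ n / (n ! : ℝ) * c n :=
    (summable_nat_add_iff 1).1 hsum.summable
  rw [hs.tsum_eq_zero_add, ← hsum.tsum_eq]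
  simp

section Semigroup

variable {d : ℕ} {ω : Environment d}

/-- The generator is local: iterates on truncated functions are eventually constant. -/
theorem eventually_iterate_generator_eq {g : (Fin d → ℤ) → ℝ} {G : ℕ → (Fin d → ℤ) → ℝ}
    (hG : ∀ x, ∀ᶠ N in atTop, G N x = g x) (n : ℕ) (x : Fin d → ℤ) :
    ∀ᶠ N in atTop, ((generator ω)^[n] (G N)) x = ((generator ω)^[n] g) x := by
  induction n generalizing x with
  | zero => exact hG x
  | succ n ih =>
    simp only [Function.iterate_succ_apply']
    have h : ∀ᶠ N in atTop, ∀ y ∈ (latticeGraph d).neighborFinset x,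
        ((generator ω)^[n] (G N)) y = ((generator ω)^[n] g) y :=
      (Filter.eventually_all_finset _).2 fun y _ => ih y
    filter_upwards [h, ih x] with N hN hx
    exact Finset.sum_congr rfl fun y hy => by rw [hN y hy, hx]

/-- Each term of the series is eventually constant in `N` by locality of the generator, and the
bounds uniform in `N` allow dominated convergence. -/
theorem tendsto_semigroup {g w : (Fin d → ℤ) → ℝ} {G : ℕ → (Fin d → ℤ) → ℝ} {K C : ℝ}
    (hG : ∀ x, ∀ᶠ N in atTop, G N x = g x) {x : Fin d → ℤ}
    (hb : ∀ N n, |((generator ω)^[n] (G N)) x| ≤ K ^ n * C * w x) (t : ℝ≥0) :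
    Tendsto (fun N => semigroup ω t (G N) x) atTop (𝓝 (semigroup ω t g x)) := by
  refine tendsto_tsum_of_dominated_convergence
    (bound := fun n => (t * K) ^ n / (n ! : ℝ) * (C * w x))
    ((Real.summable_pow_div_factorial (t * K)).mul_right _) (fun n => ?_)
    (.of_forall fun N n => ?_)
  · refine Tendsto.congr' ?_ tendsto_const_nhds
    filter_upwards [eventually_iterate_generator_eq (ω := ω) hG n x] with N hN
    rw [hN]
  · rw [Real.norm_eq_abs, abs_mul, abs_of_nonneg (by positivity)]
    calc _ ≤ (t : ℝ) ^ n / (n ! : ℝ) * (K ^ n * C * w x) :=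
          mul_le_mul_of_nonneg_left (hb N n) (by positivity)
      _ = _ := by rw [mul_pow]; ring

end Semigroup

/-- Testing against events of `𝓕 s` replaces conditional expectations by plain integrals, to which
Fubini and termwise integration apply. -/
theorem martingale_of_setIntegral_eq {Ω : Type*} {m : MeasurableSpace Ω} {P : Measure Ω}
    [IsFiniteMeasure P] {𝓕 : Filtration ℝ≥0 m} {M : ℝ≥0 → Ω → ℝ} (hM : Adapted 𝓕 M)
    (hi : ∀ t, Integrable (M t) P)
    (h : ∀ s t, s ≤ t → ∀ A, MeasurableSet[𝓕 s] A → ∫ a in A, M s a ∂P = ∫ a in A, M t a ∂P) :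
    Martingale M 𝓕 P := by
  refine ⟨hM.stronglyAdapted, fun s t hst => ?_⟩
  exact (ae_eq_condExp_of_forall_setIntegral_eq (𝓕.le s) (hi t)
    (fun A _ _ => (hi s).integrableOn) (fun A hA _ => h s t hst A hA)
    (hM s).stronglyMeasurable.aestronglyMeasurable).symm

/-! ### Exponential moments, Markov property and Dynkin's formula -/

namespace IsConductanceWalk

variable {d : ℕ} {ω : Environment d} {Ω : Type*} {m : MeasurableSpace Ω} {P : Measure Ω}
  {𝓕 : Filtration ℝ≥0 m} {X : ℝ≥0 → Ω → (Fin d → ℤ)} {x₀ : Fin d → ℤ}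

theorem measurable_comp (hX : IsConductanceWalk ω x₀ P 𝓕 X) (h : (Fin d → ℤ) → ℝ) (t : ℝ≥0) :
    Measurable fun a => h (X t a) :=
  (Measurable.of_discrete (f := h)).comp hX.adapted.measurable

theorem setIntegral_of_bounded (hX : IsConductanceWalk ω x₀ P 𝓕 X) {g : (Fin d → ℤ) → ℝ}
    (hg : ∃ C : ℝ, ∀ x, |g x| ≤ C) (s t : ℝ≥0) {A : Set Ω} (hA : MeasurableSet[𝓕 s] A) :
    ∫ a in A, g (X (s + t) a) ∂P = ∫ a in A, semigroup ω t g (X s a) ∂P := by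
  have := hX.isProbabilityMeasure
  obtain ⟨C, hC⟩ := hg
  have hi : Integrable (fun a => g (X (s + t) a)) P :=
    Integrable.of_bound (hX.measurable_comp g _).aestronglyMeasurable C (.of_forall fun a => hC _)
  rw [← setIntegral_condExp (𝓕.le s) hi hA]
  exact setIntegral_congr_ae (𝓕.le s _ hA) ((hX.markov s t g ⟨C, hC⟩).mono fun a ha _ => ha)

/-- Exponential moments of the walk are locally bounded in time. -/
theorem exists_integral_exp_le (hX : IsConductanceWalk ω x₀ P 𝓕 X) (hω : IsElliptic ω)
    {α : ℝ} (hα : 0 ≤ α) :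
    ∃ K : ℝ, 0 ≤ K ∧ ∀ t, Integrable (fun a => Real.exp (α * ‖X t a‖)) P ∧
      ∫ a, Real.exp (α * ‖X t a‖) ∂P ≤ Real.exp (K * t) * Real.exp (α * ‖x₀‖) := by
  have := hX.isProbabilityMeasure
  obtain ⟨K, hK, hL⟩ := hω.exists_iterate_generator_le α
  refine ⟨K, hK, fun t => ?_⟩
  set B := Real.exp (K * t) * Real.exp (α * ‖x₀‖) with hB
  -- Truncated weights: bounded for each `N`, with `K` and hence the moment bound `B` independent of
  -- `N`.
  let g : ℕ → (Fin d → ℤ) → ℝ := fun N x => Real.exp (α * min ‖x‖ N)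
  have hg : ∀ N x, |g N x| ≤ Real.exp (α * N) := fun N x => by
    rw [abs_of_pos (Real.exp_pos _), Real.exp_le_exp]
    exact mul_le_mul_of_nonneg_left (min_le_right _ _) hα
  have hint : ∀ N, ∫ a, g N (X t a) ∂P ≤ B := fun N => by
    have h := hX.setIntegral_of_bounded ⟨_, hg N⟩ 0 t MeasurableSet.univ
    rw [setIntegral_univ, setIntegral_univ, zero_add] at h
    have h0 : ∫ a, semigroup ω t (g N) (X 0 a) ∂P = semigroup ω t (g N) x₀ := by
      rw [integral_congr_ae (g := fun _ => semigroup ω t (g N) x₀)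
        (hX.start.mono fun a ha => by simp only [ha])]
      simp
    rw [h, h0]
    have hb := (summable_semigroup_of_le (K := K) (C := g N x₀) (fun n => by
      simpa using hL _ (isWeight_exp_min hα N) (g N) 1 zero_le_one
        (fun x => by rw [one_mul, abs_of_pos (Real.exp_pos _)]) n x₀) t t.coe_nonneg).2
    refine (le_abs_self _).trans (hb.trans ?_)
    refine mul_le_mul_of_nonneg_left ?_ (Real.exp_pos _).le
    exact Real.exp_le_exp.2 (mul_le_mul_of_nonneg_left (min_le_left _ _) hα)
  have hlim : ∀ x : Fin d → ℤ, Tendsto (fun N => ENNReal.ofReal (g N x)) atTop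
      (𝓝 (ENNReal.ofReal (Real.exp (α * ‖x‖)))) := fun x => by
    refine tendsto_const_nhds.congr' ?_
    filter_upwards [eventually_ge_atTop ⌈‖x‖⌉₊] with N hN
    simp only [g, min_eq_left (Nat.ceil_le.1 hN)]
  -- Fatou's lemma as `N → ∞`.
  have hlint : ∫⁻ a, ENNReal.ofReal (Real.exp (α * ‖X t a‖)) ∂P ≤ ENNReal.ofReal B := by
    calc _ = ∫⁻ a, liminf (fun N => ENNReal.ofReal (g N (X t a))) atTop ∂P :=
          lintegral_congr fun a => (hlim _).liminf_eq.symm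
      _ ≤ liminf (fun N => ∫⁻ a, ENNReal.ofReal (g N (X t a)) ∂P) atTop :=
          lintegral_liminf_le fun N => (hX.measurable_comp (g N) t).ennreal_ofReal
      _ ≤ ENNReal.ofReal B := by
          refine liminf_le_of_le (by isBoundedDefault) fun b hb => ?_
          obtain ⟨N, hN⟩ := hb.exists
          refine hN.trans ?_
          rw [← ofReal_integral_eq_lintegral_ofReal]
          · exact ENNReal.ofReal_le_ofReal (hint N)
          · exact Integrable.of_bound (hX.measurable_comp (g N) _).aestronglyMeasurable _
              (.of_forall fun a => hg N _)
          · exact .of_forall fun a => (Real.exp_pos _).le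
  have hm : AEStronglyMeasurable (fun a => Real.exp (α * ‖X t a‖)) P :=
    (hX.measurable_comp (fun x => Real.exp (α * ‖x‖)) t).aestronglyMeasurable
  refine ⟨⟨hm, ?_⟩, ?_⟩
  · rw [hasFiniteIntegral_iff_ofReal (.of_forall fun a => (Real.exp_pos _).le)]
    exact hlint.trans_lt ENNReal.ofReal_lt_top
  · rw [integral_eq_lintegral_of_nonneg_ae (.of_forall fun a => (Real.exp_pos _).le) hm]
    exact ENNReal.toReal_le_of_le_ofReal (by positivity) hlint

theorem integrable_comp (hX : IsConductanceWalk ω x₀ P 𝓕 X) (hω : IsElliptic ω)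
    {h : (Fin d → ℤ) → ℝ} (hh : IsExpBounded h) (t : ℝ≥0) :
    Integrable (fun a => h (X t a)) P := by
  obtain ⟨α, C, hα, hC, hh⟩ := hh
  obtain ⟨K, hK, hm⟩ := hX.exists_integral_exp_le hω hα
  exact ((hm t).1.const_mul C).mono' (hX.measurable_comp h t).aestronglyMeasurable
    (.of_forall fun a => hh _)

/-- Joint integrability in time and space of a function of the walk. -/
theorem integrable_prod (hX : IsConductanceWalk ω x₀ P 𝓕 X) (hω : IsElliptic ω)
    {h : (Fin d → ℤ) → ℝ} (hh : IsExpBounded h) (s t : ℝ≥0) :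
    Integrable (fun z : ℝ × Ω => h (X z.1.toNNReal z.2))
      ((volume.restrict (Set.Ioc (s : ℝ) t)).prod P) := by
  have := hX.isProbabilityMeasure
  have hmeas : Measurable fun z : ℝ × Ω => h (X z.1.toNNReal z.2) :=
    (Measurable.of_discrete (f := h)).comp
      ((measurable_uncurry_of_adapted hX.adapted hX.cadlag).comp
        ((measurable_real_toNNReal.comp measurable_fst).prodMk measurable_snd))
  rw [integrable_prod_iff hmeas.aestronglyMeasurable]
  refine ⟨.of_forall fun r => hX.integrable_comp hω hh r.toNNReal, ?_⟩
  obtain ⟨α, C, hα, hC, hh'⟩ := hh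
  obtain ⟨K, hK, hm⟩ := hX.exists_integral_exp_le hω hα
  refine Measure.integrableOn_of_bounded (by simp)
    (M := C * (Real.exp (K * t) * Real.exp (α * ‖x₀‖)))
    hmeas.norm.stronglyMeasurable.integral_prod_right'.aestronglyMeasurable ?_
  refine (ae_restrict_mem measurableSet_Ioc).mono fun r hr => ?_
  rw [Real.norm_eq_abs, abs_of_nonneg (integral_nonneg fun a => norm_nonneg _)]
  calc _ ≤ ∫ a, C * Real.exp (α * ‖X r.toNNReal a‖) ∂P :=
        integral_mono (hX.integrable_comp hω ⟨α, C, hα, hC, hh'⟩ _).norm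
          ((hm _).1.const_mul C) fun a => hh' _
    _ = C * ∫ a, Real.exp (α * ‖X r.toNNReal a‖) ∂P := integral_const_mul _ _
    _ ≤ C * (Real.exp (K * r.toNNReal) * Real.exp (α * ‖x₀‖)) := by gcongr; exact (hm _).2
    _ ≤ _ := by
      gcongr
      exact Real.toNNReal_le_iff_le_coe.2 hr.2

/-- The Markov property for functions of exponential growth. -/
theorem setIntegral_eq_semigroup (hX : IsConductanceWalk ω x₀ P 𝓕 X) (hω : IsElliptic ω)
    {g : (Fin d → ℤ) → ℝ} (hg : IsExpBounded g) (s t : ℝ≥0) {A : Set Ω}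
    (hA : MeasurableSet[𝓕 s] A) :
    ∫ a in A, g (X (s + t) a) ∂P = ∫ a in A, semigroup ω t g (X s a) ∂P := by
  classical
  have := hX.isProbabilityMeasure
  have hgi := hX.integrable_comp hω hg (s + t)
  obtain ⟨α, C, hα, hC, hg⟩ := hg
  obtain ⟨K, hK, hL⟩ := hω.exists_iterate_generator_le α
  let G : ℕ → (Fin d → ℤ) → ℝ := fun N x => if ‖x‖ ≤ N then g x else 0
  have hGg : ∀ N x, |G N x| ≤ |g x| := fun N x => by
    simp only [G]; split_ifs <;> simp
  have hG : ∀ x, ∀ᶠ N in atTop, G N x = g x := fun x => by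
    filter_upwards [eventually_ge_atTop ⌈‖x‖⌉₊] with N hN
    simp only [G, if_pos (Nat.ceil_le.1 hN)]
  have hGb : ∀ N, ∃ D : ℝ, ∀ x, |G N x| ≤ D := fun N => by
    refine ⟨C * Real.exp (α * N), fun x => ?_⟩
    simp only [G]
    split_ifs with h
    · exact (hg x).trans (by gcongr)
    · rw [abs_zero]; positivity
  have hb : ∀ x N n, |((generator ω)^[n] (G N)) x| ≤ K ^ n * C * Real.exp (α * ‖x‖) :=
    fun x N n => hL _ (isWeight_exp hα) _ C hC (fun x => (hGg N x).trans (hg x)) n x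
  obtain ⟨K', -, hm⟩ := hX.exists_integral_exp_le hω hα
  have h1 : Tendsto (fun N => ∫ a in A, G N (X (s + t) a) ∂P) atTop
      (𝓝 (∫ a in A, g (X (s + t) a) ∂P)) :=
    tendsto_integral_of_dominated_convergence (fun a => |g (X (s + t) a)|)
      (fun N => (hX.measurable_comp (G N) _).aestronglyMeasurable) hgi.norm.integrableOn
      (fun N => .of_forall fun a => hGg N _)
      (.of_forall fun a => tendsto_const_nhds.congr' ((hG _).mono fun N hN => hN.symm))
  have h2 : Tendsto (fun N => ∫ a in A, semigroup ω t (G N) (X s a) ∂P) atTop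
      (𝓝 (∫ a in A, semigroup ω t g (X s a) ∂P)) := by
    refine tendsto_integral_of_dominated_convergence
      (fun a => Real.exp (K * t) * C * Real.exp (α * ‖X s a‖))
      (fun N => (hX.measurable_comp (semigroup ω t (G N)) _).aestronglyMeasurable)
      ((hm s).1.const_mul _).integrableOn (fun N => .of_forall fun a => ?_)
      (.of_forall fun a => tendsto_semigroup (w := fun x => Real.exp (α * ‖x‖)) hG (hb _) t)
    rw [mul_assoc]
    exact (summable_semigroup_of_le (fun n => (hb (X s a) N n).trans_eq (mul_assoc _ _ _)) t t.coe_nonneg).2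
  refine tendsto_nhds_unique h1 (h2.congr fun N => ?_)
  exact (hX.setIntegral_of_bounded (hGb N) s t hA).symm

/-- With `c n = E[Lⁿ f(X_s); A]`, the expectations of `f` and of `Lf` at time `s + r` are the
exponential generating series of `c n` and `c (n + 1)`, so the second is the derivative of the
first. -/
theorem setIntegral_sub_eq (hX : IsConductanceWalk ω x₀ P 𝓕 X) (hω : IsElliptic ω)
    {f : (Fin d → ℤ) → ℝ} (hf : IsExpBounded f) (s t : ℝ≥0) {A : Set Ω}
    (hA : MeasurableSet[𝓕 s] A) :
    ∫ a in A, f (X (s + t) a) ∂P - ∫ a in A, f (X s a) ∂P =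
      ∫ r in (0 : ℝ)..t, ∫ a in A, generator ω f (X (s + r.toNNReal) a) ∂P := by
  have := hX.isProbabilityMeasure
  obtain ⟨α, C, hα, hC, hfb⟩ := id hf
  obtain ⟨K, hK, hL⟩ := hω.exists_iterate_generator_le α
  obtain ⟨K', -, hm⟩ := hX.exists_integral_exp_le hω hα
  have hb := hL _ (isWeight_exp hα) f C hC hfb
  set c : ℕ → ℝ := fun n => ∫ a in A, ((generator ω)^[n] f) (X s a) ∂P with hc
  set D : ℝ := C * ∫ a, Real.exp (α * ‖X s a‖) ∂P with hD
  have hint : ∀ n, Integrable (fun a => ((generator ω)^[n] f) (X s a)) P := fun n =>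
    hX.integrable_comp hω ⟨α, K ^ n * C, hα, by positivity, hb n⟩ s
  have hnorm : ∀ n, ∫ a in A, ‖((generator ω)^[n] f) (X s a)‖ ∂P ≤ K ^ n * D := fun n => by
    calc _ ≤ ∫ a, ‖((generator ω)^[n] f) (X s a)‖ ∂P :=
          setIntegral_le_integral (hint n).norm (.of_forall fun a => norm_nonneg _)
      _ ≤ ∫ a, K ^ n * C * Real.exp (α * ‖X s a‖) ∂P :=
          integral_mono (hint n).norm ((hm s).1.const_mul _) fun a => hb n _
      _ = _ := by rw [integral_const_mul, hD, mul_assoc]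
  have hcb : ∀ n, |c n| ≤ K ^ n * D := fun n => (norm_integral_le_integral_norm _).trans (hnorm n)
  have hD0 : 0 ≤ D := mul_nonneg hC (integral_nonneg fun a => (Real.exp_pos _).le)
  -- Stated for a general shift `k`, since both `k = 0` (for `f`) and `k = 1` (for `Lf`) are needed.
  have hsum : ∀ (h : (Fin d → ℤ) → ℝ) (k : ℕ), h = (generator ω)^[k] f → ∀ r : ℝ≥0,
      ∫ a in A, h (X (s + r) a) ∂P = ∑' n : ℕ, (r : ℝ) ^ n / (n ! : ℝ) * c (n + k) := by
    intro h k hh r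
    have hhb : IsExpBounded h := ⟨α, K ^ k * C, hα, by positivity, fun x => hh ▸ hb k x⟩
    rw [hX.setIntegral_eq_semigroup hω hhb s r hA]
    have hit : ∀ n, (generator ω)^[n] h = (generator ω)^[n + k] f := fun n => by
      rw [hh, Function.iterate_add_apply]
    simp only [semigroup, hit]
    rw [← integral_tsum_of_summable_integral_norm]
    · exact tsum_congr fun n => integral_const_mul _ _
    · exact fun n => ((hint _).const_mul _).integrableOn
    · refine Summable.of_nonneg_of_le (fun n => integral_nonneg fun a => norm_nonneg _)
        (fun n => ?_) ((Real.summable_pow_div_factorial (r * K)).mul_right (K ^ k * D))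
      simp only [norm_mul]
      rw [integral_const_mul, Real.norm_of_nonneg (by positivity)]
      calc _ ≤ (r : ℝ) ^ n / (n ! : ℝ) * (K ^ (n + k) * D) :=
            mul_le_mul_of_nonneg_left (hnorm _) (by positivity)
        _ = _ := by rw [mul_pow, pow_add]; ring
  rw [hsum f 0 rfl t]
  have h0 : ∫ a in A, f (X s a) ∂P = c 0 := rfl
  rw [h0]
  simp only [add_zero]
  rw [tsum_sub_eq_integral hK hD0 hcb t.coe_nonneg]
  refine intervalIntegral.integral_congr fun r hr => ?_
  rw [Set.uIcc_of_le t.coe_nonneg] at hr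
  rw [hsum (generator ω f) 1 rfl, Real.coe_toNNReal _ hr.1]

theorem setIntegral_sub_eq_integral (hX : IsConductanceWalk ω x₀ P 𝓕 X) (hω : IsElliptic ω)
    {f : (Fin d → ℤ) → ℝ} (hf : IsExpBounded f) {s t : ℝ≥0} (hst : s ≤ t) {A : Set Ω}
    (hA : MeasurableSet[𝓕 s] A) :
    ∫ a in A, f (X t a) ∂P - ∫ a in A, f (X s a) ∂P =
      ∫ a in A, (timeIntegral X (generator ω f) t a - timeIntegral X (generator ω f) s a) ∂P := by
  have := hX.isProbabilityMeasure
  obtain ⟨u, rfl⟩ := exists_add_of_le hst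
  rw [hX.setIntegral_sub_eq hω hf s u hA]
  have h1 : ∫ r in (0 : ℝ)..u, ∫ a in A, generator ω f (X (s + r.toNNReal) a) ∂P =
      ∫ r in (0 : ℝ)..u, (fun r : ℝ => ∫ a in A, generator ω f (X r.toNNReal a) ∂P) (s + r) := by
    refine intervalIntegral.integral_congr fun r hr => ?_
    rw [Set.uIcc_of_le u.coe_nonneg] at hr
    simp only
    rw [Real.toNNReal_add s.coe_nonneg hr.1, Real.toNNReal_coe]
  rw [h1, intervalIntegral.integral_comp_add_left (fun r : ℝ =>
    ∫ a in A, generator ω f (X r.toNNReal a) ∂P), add_zero, ← NNReal.coe_add,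
    intervalIntegral.integral_of_le (by exact_mod_cast hst)]
  simp_rw [timeIntegral_sub hX.adapted hX.cadlag,
    intervalIntegral.integral_of_le (show (s : ℝ) ≤ (s + u : ℝ≥0) by exact_mod_cast hst)]
  refine integral_integral_swap (f := fun (r : ℝ) a => generator ω f (X r.toNNReal a)) ?_
  refine (hX.integrable_prod hω (hf.generator hω) s (s + u)).mono_measure ?_
  exact Measure.prod_mono le_rfl Measure.restrict_le_self

theorem integrable_timeIntegral (hX : IsConductanceWalk ω x₀ P 𝓕 X) (hω : IsElliptic ω)
    {h : (Fin d → ℤ) → ℝ} (hh : IsExpBounded h) (t : ℝ≥0) :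
    Integrable (timeIntegral X h t) P := by
  have := hX.isProbabilityMeasure
  refine (hX.integrable_prod hω hh 0 t).integral_prod_right.congr (.of_forall fun a => ?_)
  exact (intervalIntegral.integral_of_le t.coe_nonneg).symm

theorem integrable_dynkinProcess (hX : IsConductanceWalk ω x₀ P 𝓕 X) (hω : IsElliptic ω)
    {f : (Fin d → ℤ) → ℝ} (hf : IsExpBounded f) (t : ℝ≥0) :
    Integrable (dynkinProcess ω X f t) P :=
  ((hX.integrable_comp hω hf t).sub (hX.integrable_comp hω hf 0)).sub
    (hX.integrable_timeIntegral hω (hf.generator hω) t)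

theorem martingale_dynkinProcess (hX : IsConductanceWalk ω x₀ P 𝓕 X) (hω : IsElliptic ω)
    {f : (Fin d → ℤ) → ℝ} (hf : IsExpBounded f) : Martingale (dynkinProcess ω X f) 𝓕 P := by
  have := hX.isProbabilityMeasure
  refine martingale_of_setIntegral_eq (adapted_dynkinProcess ω hX.adapted hX.cadlag f)
    (hX.integrable_dynkinProcess hω hf) fun s t hst A hA => ?_
  have h := hX.setIntegral_sub_eq_integral hω hf hst hA
  have hi := fun r => (hX.integrable_timeIntegral hω (hf.generator hω) r).integrableOn (s := A)
  have hc := fun r => (hX.integrable_comp hω hf r).integrableOn (s := A)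
  rw [integral_sub (hi t) (hi s)] at h
  have hd : ∀ r, ∫ a in A, dynkinProcess ω X f r a ∂P = ∫ a in A, f (X r a) ∂P -
      ∫ a in A, f (X 0 a) ∂P - ∫ a in A, timeIntegral X (generator ω f) r a ∂P := fun r => by
    exact (integral_sub ((hc r).sub (hc 0)) (hi r)).trans
      (congrArg (· - _) (integral_sub (hc r) (hc 0)))
  rw [hd, hd]
  linarith

end IsConductanceWalk

/-! ### Pathwise calculus and orthogonality of increments -/

/-- A right-continuous function times its primitive integrates to half the square of the
primitive. -/
theorem integral_mul_primitive_of_rightContinuous {p : ℝ → ℝ} (hm : Measurable p)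
    (hi : ∀ s t, IntervalIntegrable p volume s t)
    (hc : ∀ r, ContinuousWithinAt p (Set.Ioi r) r) {t : ℝ} (ht : 0 ≤ t) :
    ∫ r in (0 : ℝ)..t, p r * ∫ u in (0 : ℝ)..r, p u = (∫ u in (0 : ℝ)..t, p u) ^ 2 / 2 := by
  have hcont : Continuous fun r => ∫ u in (0 : ℝ)..r, p u :=
    intervalIntegral.continuous_primitive hi 0
  have h := intervalIntegral.integral_eq_sub_of_hasDeriv_right_of_le ht
    -- The path jumps, so only the right derivative of its primitive is available everywhere; for a
    -- continuous function this suffices.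
    (f := fun r => (∫ u in (0 : ℝ)..r, p u) ^ 2 / 2)
    (f' := fun r => p r * ∫ u in (0 : ℝ)..r, p u)
    (by fun_prop) (fun r _ => ?_) ((hi 0 t).mul_continuousOn hcont.continuousOn)
  · simpa using h
  · have h1 : HasDerivWithinAt (fun r => ∫ u in (0 : ℝ)..r, p u) (p r) (Set.Ioi r) r :=
      (intervalIntegral.integral_hasDerivWithinAt_right (hi 0 r)
        (s := Set.Ici r) (t := Set.Ioi r)
        hm.stronglyMeasurable.stronglyMeasurableAtFilter (hc r)).mono Set.Ioi_subset_Ici_self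
    refine ((h1.pow 2).div_const 2).congr_deriv ?_
    simp
    ring

/-- The Cauchy-Schwarz inequality for time integrals. -/
theorem sq_integral_le_mul_integral_sq {p : ℝ → ℝ} {t : ℝ} (ht : 0 ≤ t)
    (hi : IntervalIntegrable p volume 0 t)
    (hi2 : IntervalIntegrable (fun r => p r ^ 2) volume 0 t) :
    (∫ r in (0 : ℝ)..t, p r) ^ 2 ≤ t * ∫ r in (0 : ℝ)..t, p r ^ 2 := by
  rcases ht.eq_or_lt with rfl | ht'
  · simp
  set I := ∫ r in (0 : ℝ)..t, p r with hI
  -- Nonnegativity of the variance of `p` over `[0, t]`, scaled by `t` to avoid division.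
  have h0 : 0 ≤ ∫ r in (0 : ℝ)..t, (t * p r - I) ^ 2 :=
    intervalIntegral.integral_nonneg ht fun r _ => sq_nonneg _
  have h1 : ∫ r in (0 : ℝ)..t, (t * p r - I) ^ 2 =
      t * (t * (∫ r in (0 : ℝ)..t, p r ^ 2) - I ^ 2) := by
    have : ∀ r, (t * p r - I) ^ 2 = t ^ 2 * p r ^ 2 - 2 * t * I * p r + I ^ 2 := fun r => by ring
    simp only [this]
    rw [intervalIntegral.integral_add ((hi2.const_mul _).sub (hi.const_mul _))
      intervalIntegrable_const, intervalIntegral.integral_sub (hi2.const_mul _) (hi.const_mul _),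
      intervalIntegral.integral_const_mul, intervalIntegral.integral_const_mul,
      intervalIntegral.integral_const, ← hI]
    simp only [sub_zero, smul_eq_mul]
    ring
  rw [h1] at h0
  linarith [nonneg_of_mul_nonneg_right h0 ht']

/-- Increments of a square-integrable martingale are orthogonal to the past. -/
theorem integral_mul_sub_eq_zero_of_martingale {Ω : Type*} {m : MeasurableSpace Ω} {P : Measure Ω}
    [IsFiniteMeasure P] {𝓕 : Filtration ℝ≥0 m} {M : ℝ≥0 → Ω → ℝ} (hM : Martingale M 𝓕 P)
    (hM2 : ∀ t, MemLp (M t) 2 P) {s t : ℝ≥0} (hst : s ≤ t) {G : Ω → ℝ}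
    (hG : Measurable[𝓕 s] G) (hG2 : MemLp G 2 P) :
    ∫ a, G a * (M t a - M s a) ∂P = 0 := by
  have hi : Integrable (G * (M t - M s)) P := hG2.integrable_mul ((hM2 t).sub (hM2 s))
  have hd : Integrable (M t - M s) P := (hM.integrable t).sub (hM.integrable s)
  have h0 : P[M t - M s | 𝓕 s] =ᵐ[P] 0 := by
    filter_upwards [condExp_sub (hM.integrable t) (hM.integrable s) (𝓕 s),
      hM.condExp_ae_eq hst, hM.condExp_ae_eq (le_refl s)] with a h1 h2 h3
    rw [h1, Pi.sub_apply, h2, h3, sub_self, Pi.zero_apply]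
  have h1 := condExp_mul_of_stronglyMeasurable_left hG.stronglyMeasurable hi hd
  change ∫ a, (G * (M t - M s)) a ∂P = 0
  rw [← integral_condExp (𝓕.le s), integral_congr_ae h1]
  rw [integral_congr_ae (g := fun _ => 0), integral_zero]
  filter_upwards [h0] with a ha
  simp [ha]

section Paths

variable {d : ℕ} {Ω : Type*} {m : MeasurableSpace Ω} {𝓕 : Filtration ℝ≥0 m}
  {X : ℝ≥0 → Ω → (Fin d → ℤ)}

theorem rightContinuous_path (hc : ∀ a, IsCadlag fun t => X t a)
    (h : (Fin d → ℤ) → ℝ) (a : Ω) (r : ℝ) :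
    ContinuousWithinAt (fun r : ℝ => h (X r.toNNReal a)) (Set.Ioi r) r := by
  refine (continuous_of_discreteTopology (f := h)).continuousAt.comp_continuousWithinAt
    (((hc a).1 r.toNNReal).comp (f := Real.toNNReal) (t := Set.Ici r.toNNReal)
      continuous_real_toNNReal.continuousWithinAt fun s hs => ?_)
  exact Real.toNNReal_le_toNNReal (le_of_lt hs)

theorem sq_timeIntegral_le (hX : Adapted 𝓕 X) (hc : ∀ a, IsCadlag fun t => X t a)
    (h : (Fin d → ℤ) → ℝ) (t : ℝ≥0) (a : Ω) :
    timeIntegral X h t a ^ 2 ≤ t * timeIntegral X (fun x => h x ^ 2) t a :=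
  sq_integral_le_mul_integral_sq t.coe_nonneg (intervalIntegrable_path hX hc h a _ _)
    (intervalIntegrable_path hX hc (fun x => h x ^ 2) a _ _)

/-- The integral of `L f(X_r) M_f(r)`, where `M_f` is the Dynkin process. -/
theorem integral_generator_mul_dynkinProcess (ω : Environment d) (hX : Adapted 𝓕 X)
    (hc : ∀ a, IsCadlag fun t => X t a) (f : (Fin d → ℤ) → ℝ) (t : ℝ≥0) (a : Ω) :
    ∫ r in (0 : ℝ)..t, generator ω f (X r.toNNReal a) * dynkinProcess ω X f r.toNNReal a =
      timeIntegral X (fun x => f x * generator ω f x) t a -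
        f (X 0 a) * timeIntegral X (generator ω f) t a -
        timeIntegral X (generator ω f) t a ^ 2 / 2 := by
  have hi := intervalIntegrable_path hX hc (generator ω f) a
  have hfi := intervalIntegrable_path hX hc (fun x => f x * generator ω f x) a
  have hcont : Continuous fun r => ∫ u in (0 : ℝ)..r, generator ω f (X u.toNNReal a) :=
    intervalIntegral.continuous_primitive hi 0
  have h1 := integral_mul_primitive_of_rightContinuous (measurable_path hX hc (generator ω f) a)
    hi (rightContinuous_path hc _ a) t.coe_nonneg
  calc _ = ∫ r in (0 : ℝ)..t, (f (X r.toNNReal a) * generator ω f (X r.toNNReal a) -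
        f (X 0 a) * generator ω f (X r.toNNReal a) -
        generator ω f (X r.toNNReal a) * ∫ u in (0 : ℝ)..r, generator ω f (X u.toNNReal a)) := by
        refine intervalIntegral.integral_congr fun r hr => ?_
        rw [Set.uIcc_of_le t.coe_nonneg] at hr
        simp only [dynkinProcess, timeIntegral, Real.coe_toNNReal _ hr.1]
        ring
    _ = _ := by
        rw [intervalIntegral.integral_sub ((hfi _ _).sub ((hi _ _).const_mul _))
          ((hi _ _).mul_continuousOn hcont.continuousOn),
          intervalIntegral.integral_sub (hfi _ _) ((hi _ _).const_mul _),
          intervalIntegral.integral_const_mul, h1]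
        rfl

end Paths

/-! ### The quadratic variation -/

namespace IsConductanceWalk

variable {d : ℕ} {ω : Environment d} {Ω : Type*} {m : MeasurableSpace Ω} {P : Measure Ω}
  {𝓕 : Filtration ℝ≥0 m} {X : ℝ≥0 → Ω → (Fin d → ℤ)} {x₀ : Fin d → ℤ}

theorem memLp_two_comp (hX : IsConductanceWalk ω x₀ P 𝓕 X) (hω : IsElliptic ω)
    {h : (Fin d → ℤ) → ℝ} (hh : IsExpBounded h) (t : ℝ≥0) :
    MemLp (fun a => h (X t a)) 2 P :=
  (memLp_two_iff_integrable_sq (hX.measurable_comp h t).aestronglyMeasurable).2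
    (hX.integrable_comp hω hh.sq t)

theorem memLp_two_timeIntegral (hX : IsConductanceWalk ω x₀ P 𝓕 X) (hω : IsElliptic ω)
    {h : (Fin d → ℤ) → ℝ} (hh : IsExpBounded h) (t : ℝ≥0) :
    MemLp (timeIntegral X h t) 2 P := by
  have hm : Measurable (timeIntegral X h t) :=
    (adapted_timeIntegral hX.adapted hX.cadlag h).measurable
  refine (memLp_two_iff_integrable_sq hm.aestronglyMeasurable).2 ?_
  refine ((hX.integrable_timeIntegral hω hh.sq t).const_mul (t : ℝ)).mono'
    (hm.pow_const 2).aestronglyMeasurable (.of_forall fun a => ?_)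
  rw [Real.norm_of_nonneg (sq_nonneg _)]
  exact sq_timeIntegral_le hX.adapted hX.cadlag h t a

theorem memLp_two_dynkinProcess (hX : IsConductanceWalk ω x₀ P 𝓕 X) (hω : IsElliptic ω)
    {f : (Fin d → ℤ) → ℝ} (hf : IsExpBounded f) (t : ℝ≥0) :
    MemLp (dynkinProcess ω X f t) 2 P :=
  ((hX.memLp_two_comp hω hf t).sub (hX.memLp_two_comp hω hf 0)).sub
    (hX.memLp_two_timeIntegral hω (hf.generator hω) t)

/-- Licenses the Fubini exchange in the double integral of `Lf(X_r) (M_t - M_r)`. -/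
theorem integrable_prod_generator_mul (hX : IsConductanceWalk ω x₀ P 𝓕 X) (hω : IsElliptic ω)
    {f : (Fin d → ℤ) → ℝ} (hf : IsExpBounded f) (s t : ℝ≥0) :
    Integrable (fun z : ℝ × Ω => generator ω f (X z.1.toNNReal z.2) *
        (dynkinProcess ω X f t z.2 - dynkinProcess ω X f z.1.toNNReal z.2))
      ((volume.restrict (Set.Ioc (s : ℝ) t)).prod P) := by
  have := hX.isProbabilityMeasure
  have hXm : Measurable fun z : ℝ × Ω => X z.1.toNNReal z.2 :=
    (measurable_uncurry_of_adapted hX.adapted hX.cadlag).comp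
      ((measurable_real_toNNReal.comp measurable_fst).prodMk measurable_snd)
  have hMm : ∀ r, Measurable (dynkinProcess ω X f r) := fun r =>
    (adapted_dynkinProcess ω hX.adapted hX.cadlag f).measurable
  have hMm' : Measurable fun z : ℝ × Ω => dynkinProcess ω X f z.1.toNNReal z.2 :=
    (measurable_uncurry_of_rightContinuous hMm
      fun a => (isCadlag_dynkinProcess ω hX.adapted hX.cadlag f a).1).comp
        ((measurable_real_toNNReal.comp measurable_fst).prodMk measurable_snd)
  have hg := hf.generator hω
  -- In the notation set below, the dominating function comes from `|G| |F' - F - I + J| ≤ G² + 4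
  -- (F'² + F² + I² + J²)`. By Cauchy-Schwarz, `I²` and `J²` are each at most `t ∫₀ᵗ (Lf)²(X_u) du`,
  -- whence the factor `8 t`.
  have hdom := ((hX.integrable_prod hω hg.sq s t).add
    ((hX.integrable_prod hω hf.sq s t).const_mul 4)).add
    ((((hX.integrable_comp hω hf.sq t).const_mul 4).add
      ((hX.integrable_timeIntegral hω hg.sq t).const_mul (8 * (t : ℝ)))).comp_snd
        (volume.restrict (Set.Ioc (s : ℝ) t)))
  refine hdom.mono' (((Measurable.of_discrete (f := generator ω f)).comp hXm).mul
    (((hMm t).comp measurable_snd).sub hMm')).aestronglyMeasurable ?_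
  have hmem : ∀ᵐ z ∂(volume.restrict (Set.Ioc (s : ℝ) t)).prod P, z.1 ∈ Set.Ioc (s : ℝ) t :=
    Measure.quasiMeasurePreserving_fst.ae (ae_restrict_mem measurableSet_Ioc)
  filter_upwards [hmem] with z hz
  have hrt : z.1.toNNReal ≤ t := Real.toNNReal_le_iff_le_coe.2 hz.2
  have hmono := monotone_timeIntegral hX.adapted hX.cadlag
    (h := fun x => generator ω f x ^ 2) (fun x => sq_nonneg _) z.2
  have h1 := sq_timeIntegral_le hX.adapted hX.cadlag (generator ω f) t z.2
  have h2 := (sq_timeIntegral_le hX.adapted hX.cadlag (generator ω f) z.1.toNNReal z.2).trans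
    (mul_le_mul (NNReal.coe_le_coe.2 hrt) (hmono hrt)
      (intervalIntegral.integral_nonneg (NNReal.coe_nonneg _) fun _ _ => sq_nonneg _)
      t.coe_nonneg)
  simp only [Pi.add_apply, dynkinProcess, Real.norm_eq_abs, abs_mul]
  set G := generator ω f (X z.1.toNNReal z.2)
  set F := f (X z.1.toNNReal z.2)
  set F' := f (X t z.2)
  set F₀ := f (X 0 z.2)
  set I := timeIntegral X (generator ω f) t z.2
  set J := timeIntegral X (generator ω f) z.1.toNNReal z.2
  have h3 : F' - F₀ - I - (F - F₀ - J) = F' - F - I + J := by ring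
  rw [h3]
  have h4 : |G| * |F' - F - I + J| ≤ G ^ 2 + (F' - F - I + J) ^ 2 := by
    rw [← sq_abs G, ← sq_abs (F' - F - I + J)]
    nlinarith [sq_nonneg (|G| - |F' - F - I + J|), sq_nonneg |G|, sq_nonneg |F' - F - I + J|]
  have h5 : (F' - F - I + J) ^ 2 ≤ 4 * (F' ^ 2 + F ^ 2 + I ^ 2 + J ^ 2) := by
    nlinarith [sq_nonneg (F' + F), sq_nonneg (F' + I), sq_nonneg (F' - J), sq_nonneg (F - I),
      sq_nonneg (F + J), sq_nonneg (I + J)]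
  linarith

/-- `I_t M_t - ∫₀ᵗ L f(X_r) M_r dr` is a martingale, where `M` is the Dynkin process of `f` and
`I_t` is the integral of `L f(X_r)`. -/
theorem martingale_timeIntegral_mul (hX : IsConductanceWalk ω x₀ P 𝓕 X) (hω : IsElliptic ω)
    {f : (Fin d → ℤ) → ℝ} (hf : IsExpBounded f) :
    Martingale (fun t a => timeIntegral X (generator ω f) t a * dynkinProcess ω X f t a -
      (timeIntegral X (fun x => f x * generator ω f x) t a -
        f (X 0 a) * timeIntegral X (generator ω f) t a -
        timeIntegral X (generator ω f) t a ^ 2 / 2)) 𝓕 P := by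
  have := hX.isProbabilityMeasure
  have hg := hf.generator hω
  have hM := hX.martingale_dynkinProcess hω hf
  have hM2 := hX.memLp_two_dynkinProcess hω hf
  have hI2 := hX.memLp_two_timeIntegral hω hg
  have hIad := adapted_timeIntegral hX.adapted hX.cadlag (generator ω f)
  have hint : ∀ t, Integrable (fun a =>
      timeIntegral X (generator ω f) t a * dynkinProcess ω X f t a -
      (timeIntegral X (fun x => f x * generator ω f x) t a -
        f (X 0 a) * timeIntegral X (generator ω f) t a -
        timeIntegral X (generator ω f) t a ^ 2 / 2)) P := fun t =>
    ((hI2 t).integrable_mul (hM2 t)).sub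
      (((hX.integrable_timeIntegral hω (hf.mul hg) t).sub
        ((hX.memLp_two_comp hω hf 0).integrable_mul (hI2 t))).sub
          ((hI2 t).integrable_sq.div_const 2))
  refine martingale_of_setIntegral_eq (fun t => ?_) hint fun s t hst A hA => ?_
  · exact ((hIad t).mul (adapted_dynkinProcess ω hX.adapted hX.cadlag f t)).sub
      (((adapted_timeIntegral hX.adapted hX.cadlag _ t).sub
        ((Measurable.of_discrete.comp (hX.adapted.measurable_le zero_le)).mul (hIad t))).sub
          (((hIad t).pow_const 2).div_const 2))
  have hAm := 𝓕.le s _ hA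
  rw [eq_comm, ← sub_eq_zero, ← integral_sub (hint t).integrableOn (hint s).integrableOn]
  have hst' : (s : ℝ) ≤ t := by exact_mod_cast hst
  -- The increment is rewritten so that the martingale enters only through its increments after the
  -- time at which the factor in front is known.
  have hpath : ∀ a,
      (timeIntegral X (generator ω f) t a * dynkinProcess ω X f t a -
      (timeIntegral X (fun x => f x * generator ω f x) t a -
        f (X 0 a) * timeIntegral X (generator ω f) t a -
        timeIntegral X (generator ω f) t a ^ 2 / 2)) -
      (timeIntegral X (generator ω f) s a * dynkinProcess ω X f s a -
      (timeIntegral X (fun x => f x * generator ω f x) s a -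
        f (X 0 a) * timeIntegral X (generator ω f) s a -
        timeIntegral X (generator ω f) s a ^ 2 / 2)) =
      timeIntegral X (generator ω f) s a * (dynkinProcess ω X f t a - dynkinProcess ω X f s a) +
      ∫ r in Set.Ioc (s : ℝ) t, generator ω f (X r.toNNReal a) *
        (dynkinProcess ω X f t a - dynkinProcess ω X f r.toNNReal a) := fun a => by
    have hii : ∀ u v, IntervalIntegrable (fun r => generator ω f (X r.toNNReal a)) volume u v :=
      intervalIntegrable_path hX.adapted hX.cadlag (generator ω f) a
    have hiM : ∀ u v, IntervalIntegrable (fun r => generator ω f (X r.toNNReal a) *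
        dynkinProcess ω X f r.toNNReal a) volume u v := fun u v => by
      have hcI : Continuous fun r : ℝ => timeIntegral X (generator ω f) r.toNNReal a :=
        (continuous_timeIntegral hX.adapted hX.cadlag _ a).comp continuous_real_toNNReal
      refine (((intervalIntegrable_path hX.adapted hX.cadlag
        (fun x => generator ω f x * f x) a u v).sub ((hii u v).mul_const (f (X 0 a)))).sub
        ((hii u v).mul_continuousOn hcI.continuousOn)).congr (fun r _ => ?_)
      simp only [dynkinProcess]
      ring
    rw [← integral_generator_mul_dynkinProcess ω hX.adapted hX.cadlag,
      ← integral_generator_mul_dynkinProcess ω hX.adapted hX.cadlag,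
      ← intervalIntegral.integral_of_le hst']
    simp only [mul_sub]
    rw [intervalIntegral.integral_sub ((hii _ _).mul_const _) (hiM _ _),
      intervalIntegral.integral_mul_const, ← timeIntegral_sub hX.adapted hX.cadlag,
      ← intervalIntegral.integral_interval_sub_left (hiM 0 t) (hiM 0 s)]
    ring
  simp only [hpath]
  have hprod := hX.integrable_prod_generator_mul hω hf s t
  have hprodA : Integrable (fun z : ℝ × Ω => generator ω f (X z.1.toNNReal z.2) *
        (dynkinProcess ω X f t z.2 - dynkinProcess ω X f z.1.toNNReal z.2))
      ((volume.restrict (Set.Ioc (s : ℝ) t)).prod (P.restrict A)) :=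
    hprod.mono_measure (Measure.prod_mono le_rfl Measure.restrict_le_self)
  -- The indicator of `A` is absorbed into `G`, since `A` belongs to `𝓕 s` and so to `𝓕 r`.
  have horth : ∀ (r : ℝ≥0), s ≤ r → r ≤ t → ∀ G : Ω → ℝ, Measurable[𝓕 r] G → MemLp G 2 P →
      ∫ a in A, G a * (dynkinProcess ω X f t a - dynkinProcess ω X f r a) ∂P = 0 := by
    intro r hsr hrt G hG hG2
    rw [← integral_indicator hAm, ← integral_mul_sub_eq_zero_of_martingale hM hM2 hrt
      (hG.indicator (𝓕.mono hsr _ hA)) (hG2.indicator hAm)]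
    refine integral_congr_ae (.of_forall fun a => ?_)
    by_cases ha : a ∈ A <;> simp [ha]
  have hi1 : Integrable (fun a => timeIntegral X (generator ω f) s a *
      (dynkinProcess ω X f t a - dynkinProcess ω X f s a)) (P.restrict A) :=
    ((hI2 s).integrable_mul ((hM2 t).sub (hM2 s))).integrableOn
  have hi2 : Integrable (fun a => ∫ r in Set.Ioc (s : ℝ) t, generator ω f (X r.toNNReal a) *
      (dynkinProcess ω X f t a - dynkinProcess ω X f r.toNNReal a)) (P.restrict A) :=
    hprodA.integral_prod_right
  rw [integral_add hi1 hi2, horth s le_rfl hst _ (hIad s) (hI2 s), zero_add,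
    ← integral_integral_swap (f := fun (r : ℝ) a => generator ω f (X r.toNNReal a) *
        (dynkinProcess ω X f t a - dynkinProcess ω X f r.toNNReal a)) hprodA]
  rw [setIntegral_congr_fun (g := fun _ => (0 : ℝ)) measurableSet_Ioc fun r hr => ?_]
  · simp
  · exact horth r.toNNReal (NNReal.le_toNNReal_of_coe_le hr.1.le)
      (Real.toNNReal_le_iff_le_coe.2 hr.2) _
      ((Measurable.of_discrete (f := generator ω f)).comp (hX.adapted _))
      (hX.memLp_two_comp hω hg _)

theorem timeIntegral_carreDuChamp (hX : IsConductanceWalk ω x₀ P 𝓕 X) (f : (Fin d → ℤ) → ℝ)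
    (t : ℝ≥0) (a : Ω) :
    timeIntegral X (carreDuChamp ω f) t a =
      timeIntegral X (generator ω fun x => f x ^ 2) t a -
        2 * timeIntegral X (fun x => f x * generator ω f x) t a := by
  have hi := fun h => intervalIntegrable_path hX.adapted hX.cadlag h a 0 t
  simp only [timeIntegral]
  rw [← intervalIntegral.integral_const_mul, ← intervalIntegral.integral_sub (hi _)
    ((hi fun x => f x * generator ω f x).const_mul 2)]
  refine intervalIntegral.integral_congr fun r _ => ?_
  simp only [carreDuChamp]
  ring

theorem martingale_sq_sub_carreDuChamp (hX : IsConductanceWalk ω x₀ P 𝓕 X) (hω : IsElliptic ω)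
    {f : (Fin d → ℤ) → ℝ} (hf : IsExpBounded f) :
    Martingale (fun t a => dynkinProcess ω X f t a ^ 2 - timeIntegral X (carreDuChamp ω f) t a)
      𝓕 P := by
  -- The combination `M_{f²} - 2 f(x₀) M_f - 2N`. It equals the target only where `X 0 = x₀`, hence
  -- the passage through almost sure equality.
  have h := ((hX.martingale_dynkinProcess hω hf.sq).sub
    ((hX.martingale_dynkinProcess hω hf).smul (2 * f x₀))).sub
    ((hX.martingale_timeIntegral_mul hω hf).smul 2)
  have had : Adapted 𝓕 fun t a =>
      dynkinProcess ω X f t a ^ 2 - timeIntegral X (carreDuChamp ω f) t a := fun t =>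
    ((adapted_dynkinProcess ω hX.adapted hX.cadlag f t).pow_const 2).sub
      (adapted_timeIntegral hX.adapted hX.cadlag _ t)
  refine h.congr had.stronglyAdapted fun t => ?_
  filter_upwards [hX.start] with a ha
  simp only [Pi.sub_apply, Pi.smul_apply, smul_eq_mul, hX.timeIntegral_carreDuChamp,
    dynkinProcess, ha]
  ring

theorem isPredictableQuadraticVariation_dynkinProcess (hX : IsConductanceWalk ω x₀ P 𝓕 X)
    (hω : IsElliptic ω) {f : (Fin d → ℤ) → ℝ} (hf : IsExpBounded f) :
    IsPredictableQuadraticVariation P 𝓕 (dynkinProcess ω X f)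
      (timeIntegral X (carreDuChamp ω f)) where
  martingale := hX.martingale_dynkinProcess hω hf
  cadlag := isCadlag_dynkinProcess ω hX.adapted hX.cadlag f
  memLp_two := hX.memLp_two_dynkinProcess hω hf
  predictable := isStronglyPredictable_of_continuous_monotone
    (adapted_timeIntegral hX.adapted hX.cadlag _)
    (continuous_timeIntegral hX.adapted hX.cadlag _)
    (monotone_timeIntegral hX.adapted hX.cadlag (carreDuChamp_nonneg ω f))
  zero := fun a => by simp [timeIntegral]
  monotone := monotone_timeIntegral hX.adapted hX.cadlag (carreDuChamp_nonneg ω f)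
  cadlag_variation := fun a =>
    isCadlag_of_continuous (continuous_timeIntegral hX.adapted hX.cadlag _ a)
  martingale_sq_sub := hX.martingale_sq_sub_carreDuChamp hω hf

end IsConductanceWalk

end RandomConductance

end

theorem mainTheorem6 {d : ℕ} (ω : Environment d) (hω : IsElliptic ω)
    (f : (Fin d → ℤ) → ℝ) (hf : HasSubexponentialGrowth f)
    {Ω : Type*} {m : MeasurableSpace Ω} (P : Measure Ω) (𝓕 : Filtration ℝ≥0 m)
    (X : ℝ≥0 → Ω → (Fin d → ℤ)) (hX : IsConductanceWalk ω 0 P 𝓕 X) :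
    Martingale (dynkinProcess ω X f) 𝓕 P ∧
      IsPredictableQuadraticVariation P 𝓕 (dynkinProcess ω X f)
        (timeIntegral X (carreDuChamp ω f)) :=
  ⟨hX.martingale_dynkinProcess hω hf.isExpBounded,
    hX.isPredictableQuadraticVariation_dynkinProcess hω hf.isExpBounded⟩
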